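/- Let $k$ be a field of characteristic zero and $R=k[x_0,x_1,x_2,x_3]$. Let $\mathcal A$ be an arrangement of finitely many distinct planes in $\mathbb P^3$, defined by nonzero, pairwise linearly independent linear forms $\ell_1,\dots,\ell_d\in R$. Put $F=\ell_1\cdots\ell_d$, and let $J=\langle \partial F/\partial x_0,\dots,\partial F/\partial x_3\rangle$ be its Jacobian ideal. Let $\overline J$ be the intersection of the height two primary ideals in a minimal primary decomposition of $J$; these primary ideals $\mathfrak q$ are the components of $\overline J$. (They are uniquely determined by $J$.) A component $\mathfrak q$ is non-reduced if $\mathfrak q\neq\sqrt{\mathfrak q}$, and a plane $\{\ell_i=0\}$ contains its support if $\ell_i\in\sqrt{\mathfrak q}$. Assume that no plane of $\mathcal A$ contains the supports of two different non-reduced components of $\overline J$. Then the subscheme $C^{red}\subset\mathbb P^3$ defined by $\sqrt J$ is arithmetically Cohen--Macaulay, i.e. the quotient of $R$ by the saturated homogeneous ideal of $C^{red}$ is a Cohen--Macaulay ring; and $R/\sqrt J$ is a Cohen--Macaulay ring. (A Noetherian ring is Cohen--Macaulay if its localization at each maximal ideal has depth equal to its Krull dimension; the zero ring, which occurs for $d=1$,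 counts as Cohen--Macaulay.) -/

import Mathlib

/-- A Noetherian local ring is Cohen--Macaulay if its depth equals its Krull dimension, i.e. if the
maximal ideal contains a regular sequence whose length is the Krull dimension. -/
def IsCohenMacaulayLocalRing (A : Type*) [CommRing A] [IsLocalRing A] : Prop :=
  IsNoetherianRing A ∧
    ∃ rs : List A, (∀ r ∈ rs, r ∈ IsLocalRing.maximalIdeal A) ∧
      RingTheory.Sequence.IsRegular A rs ∧ (rs.length : WithBot ℕ∞) = ringKrullDim A

/-- A Noetherian ring is Cohen--Macaulay if its localization at every maximal ideal is a
Cohen--Macaulay local ring (so the zero ring, the coordinate ring of the empty scheme, is one). -/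
def IsCohenMacaulayRing (A : Type*) [CommRing A] : Prop :=
  IsNoetherianRing A ∧
    ∀ (m : Ideal A) [m.IsMaximal], IsCohenMacaulayLocalRing (Localization.AtPrime m)

section Polynomial

variable {k : Type*} [Field k] {σ : Type*}

/-- The Jacobian ideal of a polynomial: the ideal generated by its first partial derivatives. -/
noncomputable def jacobianIdeal (F : MvPolynomial σ k) : Ideal (MvPolynomial σ k) :=
  Ideal.span (Set.range fun i : σ => MvPolynomial.pderiv i F)

/-- The saturation `⋃ₙ (I : 𝔪ⁿ)` of an ideal with respect to the ideal `𝔪` generated by the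
variables. It is the full homogeneous ideal of the projective scheme that `I` defines. -/
noncomputable def saturation (I : Ideal (MvPolynomial σ k)) : Ideal (MvPolynomial σ k) :=
  ⨆ n : ℕ, Submodule.colon I
    ((Ideal.span (Set.range (MvPolynomial.X : σ → MvPolynomial σ k)) ^ n :
      Ideal (MvPolynomial σ k)) : Set (MvPolynomial σ k))

/-- The projective scheme defined by the homogeneous ideal `I` is arithmetically
Cohen--Macaulay: its homogeneous coordinate ring is Cohen--Macaulay. -/
def DefinesACMScheme (I : Ideal (MvPolynomial σ k)) : Prop :=
  IsCohenMacaulayRing (MvPolynomial σ k ⧸ saturation I)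

/-- `q` is a non-reduced component of the top-dimensional part `J̄` of `J`, where `J̄` is the
intersection of the height two primary ideals in a minimal primary decomposition of `J`:
that is, `q` is one of these primary ideals, and it is not radical. -/
def IsNonreducedTopComponent (J q : Ideal (MvPolynomial σ k)) : Prop :=
  ∃ t : Finset (Ideal (MvPolynomial σ k)),
    Submodule.IsMinimalPrimaryDecomposition J t ∧ q ∈ t ∧ q.height = 2 ∧ ¬ q.IsRadical

end Polynomial

/-! By Euler's formula and the product rule, a prime contains `J` exactly when it contains two of
the forms, so `√J` is the intersection of the ideals `(ℓ i, ℓ j)` of the lines where two planes meet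
(`radical_jacobianIdeal_prod`). If a third plane contains such a line, with prime `P`, then `J ≤ P ^
2`, which makes the component at `P` non-reduced (`exists_isNonreducedTopComponent`). The hypothesis
therefore puts each plane through at most one multiple line, and the planes split into disjoint
pencils (`isPencilPartition_of_unique_nonreduced`).

Pencils are added one at a time by liaison addition (`finiteFreeQuotient_pairwiseIdeal_union`): for
a pencil `C` and a union `T` of other pencils, two exact sequences reduce the union to `T`, to `C`,
and to the complete intersection of `∏ ℓ j` over `C` with `∏ ℓ i` over `T`. The property carried
along is finite freeness over `k[y, z]`, with `y, z` linear forms independent of every pair `ℓ i, ℓ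
j`. It passes to extensions, and it implies Cohen–Macaulayness
(`isCohenMacaulayRing_of_finite_free`). -/

open MvPolynomial RingTheory.Sequence

/-! ### Finite free algebras over polynomial rings are Cohen–Macaulay. -/

/-- A weakly regular sequence on a ring is weakly regular on every flat module. -/
theorem isWeaklyRegular_of_flat_module {B M : Type*} [CommRing B] [AddCommGroup M] [Module B M]
    [Module.Flat B M] {rs : List B} (h : IsWeaklyRegular B rs) : IsWeaklyRegular M rs :=
  ((TensorProduct.rid B M).isWeaklyRegular_congr rs).mp (IsWeaklyRegular.isWeaklyRegular_lTensor (M₂ := M) h)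

/-- Division by a monic `f` makes `C[T] ⧸ (f)` free over `C`, so a sequence weakly regular on `C`
stays so on this quotient. -/
theorem isWeaklyRegular_cons_monic {C : Type*} [CommRing C] {f : Polynomial C} (hf : f.Monic)
    {rs : List C} (h : IsWeaklyRegular C rs) :
    IsWeaklyRegular (Polynomial C) (f :: rs.map Polynomial.C) := by
  refine IsWeaklyRegular.cons ?_ ?_
  · intro a b hab
    exact hf.isRegular.left hab
  · rw [← Polynomial.algebraMap_eq, isWeaklyRegular_map_algebraMap_iff]
    have e : QuotSMulTop f (Polynomial C) ≃ₗ[Polynomial C] Polynomial C ⧸ Ideal.span {f} :=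
      Submodule.quotEquivOfEq _ _ (Submodule.ext fun x => by
        simp [Submodule.mem_smul_pointwise_iff_exists, Ideal.mem_span_singleton, dvd_def, eq_comm])
    have := hf.free_quotient
    have : IsWeaklyRegular (Polynomial C ⧸ Ideal.span {f}) rs := isWeaklyRegular_of_flat_module h
    exact ((e.restrictScalars C).isWeaklyRegular_congr rs).mpr this

/-- In a polynomial ring over a field, monic polynomials in the single variables form a
weakly regular sequence. -/
theorem MvPolynomial.isWeaklyRegular_ofFn_aeval_X {k : Type*} [Field k] {n : ℕ}
    (f : Fin n → Polynomial k) (hf : ∀ i, (f i).Monic) :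
    IsWeaklyRegular (MvPolynomial (Fin n) k)
      (List.ofFn fun i => Polynomial.aeval (MvPolynomial.X i : MvPolynomial (Fin n) k) (f i)) := by
  induction n with
  | zero => simp
  | succ n ih =>
    have key := isWeaklyRegular_cons_monic
      ((hf 0).map (algebraMap k (MvPolynomial (Fin n) k))) (ih (fun i => f i.succ) fun i => hf _)
    let e := MvPolynomial.finSuccEquiv k n
    refine (AddEquiv.isWeaklyRegular_congr (e := e.toAddEquiv) ?_).mpr key
    rw [List.ofFn_succ, List.forall₂_cons]
    have aux : ∀ (a : MvPolynomial (Fin (n+1)) k) b, e a = b →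
        ∀ x, e.toAddEquiv (a • x) = b • e.toAddEquiv x := by
      rintro a _ rfl x
      exact map_mul e a x
    refine ⟨aux _ _ ?_, ?_⟩
    · rw [← Polynomial.aeval_algHom_apply, MvPolynomial.finSuccEquiv_X_zero,
        ← Polynomial.aeval_map_algebraMap (MvPolynomial (Fin n) k) Polynomial.X,
        Polynomial.aeval_X_left_apply]
    · rw [List.map_ofFn, List.forall₂_iff_get]
      refine ⟨by simp, fun i h₁ h₂ => ?_⟩
      refine aux _ _ ?_
      simp only [List.get_ofFn, Function.comp_apply]
      rw [← Polynomial.aeval_algHom_apply, MvPolynomial.finSuccEquiv_X_succ]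
      exact Polynomial.aeval_algHom_apply
        (Polynomial.CAlgHom (R := k) (A := MvPolynomial (Fin n) k)) _ _

theorem ringKrullDim_le_of_isIntegral (B A : Type*) [CommRing B] [CommRing A] [Algebra B A]
    [Algebra.IsIntegral B A] : ringKrullDim A ≤ ringKrullDim B := by
  refine Order.krullDim_le_of_strictMono (PrimeSpectrum.comap (algebraMap B A)) ?_
  intro p q hpq
  exact Ideal.IsIntegral.comap_lt_comap hpq

theorem isCohenMacaulayRing_of_finite_free (k : Type*) [Field k] (n : ℕ) (A : Type*) [CommRing A]
    [Algebra (MvPolynomial (Fin n) k) A] [Module.Finite (MvPolynomial (Fin n) k) A]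
    [Module.Free (MvPolynomial (Fin n) k) A] : IsCohenMacaulayRing A := by
  set B := MvPolynomial (Fin n) k
  have hA : IsNoetherianRing A := IsNoetherianRing.of_finite B A
  refine ⟨hA, fun m hm => ⟨inferInstance, ?_⟩⟩
  let q : Ideal B := m.comap (algebraMap B A)
  have hq : q.IsMaximal := Ideal.isMaximal_comap_of_isIntegral_of_isMaximal m
  let := Ideal.Quotient.field q
  have : Module.Finite k (B ⧸ q) := finite_of_finite_type_of_isJacobsonRing _ _
  -- The residue field `B ⧸ q` is finite over `k` by the Nullstellensatz. The minimal polynomials of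
  -- the coordinates thus give `n` elements of `q` forming a weakly regular sequence, even when `q`
  -- is not a rational point.
  let f : Fin n → Polynomial k := fun i => minpoly k (Ideal.Quotient.mk q (MvPolynomial.X i))
  have hf : ∀ i, (f i).Monic := fun i => minpoly.monic (Algebra.IsIntegral.isIntegral _)
  have hreg := MvPolynomial.isWeaklyRegular_ofFn_aeval_X f hf
  have hmem : ∀ i, Polynomial.aeval (MvPolynomial.X i : B) (f i) ∈ q := by
    intro i
    rw [← Ideal.Quotient.eq_zero_iff_mem]
    exact (Polynomial.aeval_algHom_apply (Ideal.Quotient.mkₐ k q) _ _).symm.trans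
      (minpoly.aeval _ _)
  set rs := List.ofFn fun i => Polynomial.aeval (MvPolynomial.X i : B) (f i)
  have hrs : IsRegular (Localization.AtPrime m)
      ((rs.map (algebraMap B A)).map (algebraMap A (Localization.AtPrime m))) :=
    IsWeaklyRegular.isRegular_of_isLocalization_of_mem _ m hreg.of_flat (by
      intro r hr
      obtain ⟨b, hb, rfl⟩ := List.mem_map.mp hr
      obtain ⟨i, rfl⟩ := (List.mem_ofFn' _ _).mp hb
      exact hmem i)
  refine ⟨_, ?_, hrs, le_antisymm ?_ ?_⟩
  · intro r hr
    by_contra hu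
    refine hrs.2 ?_
    rw [IsLocalRing.notMem_maximalIdeal] at hu
    rw [Ideal.eq_top_of_isUnit_mem (Ideal.ofList _) (Ideal.subset_span hr) hu]; simp
  · rw [← ringKrullDim_add_length_eq_ringKrullDim_of_isRegular _ hrs]
    have : Nontrivial (Localization.AtPrime m ⧸ Ideal.ofList
        ((rs.map (algebraMap B A)).map (algebraMap A (Localization.AtPrime m)))) := by
      refine Ideal.Quotient.nontrivial_iff.mpr fun h => hrs.2 ?_
      rw [h]; simp
    exact le_add_of_nonneg_left ringKrullDim_nonneg_of_nontrivial
  -- The localization has dimension at most `dim A ≤ dim B = n`, the length of the sequence.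
  · rw [IsLocalization.AtPrime.ringKrullDim_eq_height m]
    refine (Ideal.height_le_ringKrullDim_of_ne_top hm.ne_top).trans
      ((ringKrullDim_le_of_isIntegral B A).trans ?_)
    rw [MvPolynomial.ringKrullDim_of_isNoetherianRing]
    simp [rs]

/-! ### Finite freeness along exact sequences. -/

section FiniteFreeQuotient

variable (B : Type*) {R : Type*} [CommRing B] [CommRing R] [Algebra B R]

/-- The quotient of the `B`-algebra `R` by the ideal `I` is a finite free `B`-module. -/
def FiniteFreeQuotient (I : Ideal R) : Prop :=
  Module.Finite B (R ⧸ I) ∧ Module.Free B (R ⧸ I)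

theorem finiteFreeQuotient_top : FiniteFreeQuotient B (⊤ : Ideal R) := by
  have : Subsingleton (R ⧸ (⊤ : Ideal R)) := Ideal.Quotient.subsingleton_iff.mpr rfl
  exact ⟨inferInstance, inferInstance⟩

theorem finiteFreeQuotient_of_bijective {I : Ideal R}
    (h : Function.Bijective (algebraMap B (R ⧸ I))) : FiniteFreeQuotient B I := by
  let e : B ≃ₗ[B] R ⧸ I := LinearEquiv.ofBijective (Algebra.linearMap B (R ⧸ I)) h
  exact ⟨Module.Finite.equiv e, Module.Free.of_equiv e⟩

variable {B}

/-- Multiplication by `g` gives an exact sequence `0 → R ⧸ (I : g) → R ⧸ I → R ⧸ (I + (g)) → 0`,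
along which finite freeness is inherited by the middle term. -/
theorem FiniteFreeQuotient.of_colon {I I' K : Ideal R} (g : R) (hI' : ∀ x, x * g ∈ I ↔ x ∈ I')
    (hK : K = I ⊔ Ideal.span {g}) (h' : FiniteFreeQuotient B I') (h : FiniteFreeQuotient B K) :
    FiniteFreeQuotient B I := by
  obtain ⟨_, _⟩ := h'
  obtain ⟨_, _⟩ := h
  have hle : I ≤ K := hK ▸ le_sup_left
  let f₁ : R ⧸ I' →ₗ[R] R ⧸ I := Submodule.mapQ I' I (LinearMap.mulRight R g) fun x hx => by
    simpa using (hI' x).mpr hx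
  let f₂ : R ⧸ I →ₗ[R] R ⧸ K := Submodule.factor hle
  have h₁ : ∀ w, f₁ (Submodule.Quotient.mk w) = Submodule.Quotient.mk (w * g) := fun _ => rfl
  have hf₁ : Function.Injective f₁ := by
    rw [injective_iff_map_eq_zero]
    intro a ha
    obtain ⟨x, rfl⟩ := Submodule.Quotient.mk_surjective _ a
    rw [h₁, Submodule.Quotient.mk_eq_zero] at ha
    exact (Submodule.Quotient.mk_eq_zero _).mpr ((hI' x).mp ha)
  have hf₂ : Function.Surjective f₂ := Submodule.factor_surjective hle
  have hex : Function.Exact f₁ f₂ := by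
    intro a
    obtain ⟨x, rfl⟩ := Submodule.Quotient.mk_surjective _ a
    have h₂ : f₂ (Submodule.Quotient.mk x) = Submodule.Quotient.mk x := rfl
    rw [h₂, Submodule.Quotient.mk_eq_zero, hK, Submodule.mem_sup]
    constructor
    · rintro ⟨y, hy, z, hz, rfl⟩
      obtain ⟨w, rfl⟩ := Ideal.mem_span_singleton'.mp hz
      refine ⟨Submodule.Quotient.mk w, ?_⟩
      rw [h₁, eq_comm, Submodule.Quotient.eq]
      simpa using hy
    · rintro ⟨b, hb⟩
      obtain ⟨w, rfl⟩ := Submodule.Quotient.mk_surjective _ b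
      have hb' : (Submodule.Quotient.mk (w * g) : R ⧸ I) = Submodule.Quotient.mk x := hb
      rw [eq_comm, Submodule.Quotient.eq] at hb'
      exact ⟨_, hb', w * g, Ideal.mul_mem_left _ _ (Ideal.mem_span_singleton_self g), by ring⟩
  let g₁ := f₁.restrictScalars B
  let g₂ := f₂.restrictScalars B
  refine ⟨Module.Finite.of_exact (f := g₁) (g := g₂) hex hf₂, ?_⟩
  -- The right-hand term is free over `B`, so the sequence splits `B`-linearly and the middle term
  -- is a direct sum of free modules.
  obtain ⟨s, hs⟩ := Module.projective_lifting_property g₂ LinearMap.id hf₂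
  have e := (hex.splitSurjectiveEquiv (f := g₁) (g := g₂) hf₁ ⟨s, hs⟩).1
  exact Module.Free.of_equiv e.symm

end FiniteFreeQuotient

/-! ### Ideals generated by a product and one further element. -/

section ProductIdeals

variable {R ι : Type*} [CommRing R] {s : Finset ι} {g : ι → R} {h : R}

theorem mem_of_mul_prod_mem {I : Ideal R} (hI : ∀ u ∈ s, ∀ b, b * g u ∈ I → b ∈ I) {a : R}
    (ha : a * ∏ u ∈ s, g u ∈ I) : a ∈ I := by
  classical
  induction s using Finset.induction_on generalizing a with
  | empty => simpa using ha
  | insert t s ht ih =>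
    rw [Finset.prod_insert ht, ← mul_assoc] at ha
    exact hI t (Finset.mem_insert_self t s) _
      (ih (fun u hu => hI u (Finset.mem_insert_of_mem hu)) ha)

/-- Induction on the factors: if `x = a * ∏ g u + b * h` also lies in `(g t, h)`, then cancelling
the `g u`, which are nonzerodivisors modulo `(g t, h)`, gives `a ∈ (g t, h)`. -/
theorem mem_span_pair_prod
    (hreg : ∀ t ∈ s, ∀ u ∈ s, u ≠ t → ∀ b, b * g u ∈ Ideal.span {g t, h} →
      b ∈ Ideal.span {g t, h}) {x : R} (hx : ∀ t ∈ s, x ∈ Ideal.span {g t, h}) :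
    x ∈ Ideal.span {∏ t ∈ s, g t, h} := by
  classical
  induction s using Finset.induction_on generalizing x with
  | empty => simp [Ideal.span_insert]
  | insert t s ht ih =>
    have hx' := ih (fun v hv u hu => hreg v (Finset.mem_insert_of_mem hv) u
      (Finset.mem_insert_of_mem hu)) fun v hv => hx v (Finset.mem_insert_of_mem hv)
    obtain ⟨a, b, rfl⟩ := Ideal.mem_span_pair.mp hx'
    have hxt := hx t (Finset.mem_insert_self t s)
    have hb : b * h ∈ Ideal.span {g t, h} :=
      Ideal.mul_mem_left _ _ (Ideal.subset_span (by simp))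
    have ha : a ∈ Ideal.span {g t, h} :=
      mem_of_mul_prod_mem (fun u hu => hreg t (Finset.mem_insert_self t s) u
        (Finset.mem_insert_of_mem hu) fun hut => ht (hut ▸ hu)) ((Ideal.add_mem_iff_left _ hb).mp hxt)
    obtain ⟨c, d, rfl⟩ := Ideal.mem_span_pair.mp ha
    rw [Finset.prod_insert ht]
    exact Ideal.mem_span_pair.mpr ⟨c, d * ∏ u ∈ s, g u + b, by ring⟩

/-- Splitting off one factor `g t`: the colon by the product of the others is `(g t, h)`, and adding
that product leaves the same kind of ideal with one factor fewer. -/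
theorem FiniteFreeQuotient.span_pair_prod {B : Type*} [CommRing B] [Algebra B R]
    (hreg : ∀ t ∈ s, ∀ u ∈ s, u ≠ t → ∀ b, b * g u ∈ Ideal.span {g t, h} →
      b ∈ Ideal.span {g t, h}) (hB : ∀ t ∈ s, FiniteFreeQuotient B (Ideal.span {g t, h})) :
    FiniteFreeQuotient B (Ideal.span {∏ t ∈ s, g t, h}) := by
  classical
  induction s using Finset.induction_on with
  | empty =>
    have : Ideal.span {∏ t ∈ (∅ : Finset ι), g t, h} = ⊤ := by simp [Ideal.span_insert]
    exact this ▸ finiteFreeQuotient_top B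
  | insert t s ht ih =>
    refine FiniteFreeQuotient.of_colon (∏ u ∈ s, g u) (fun x => ?_) ?_
      (hB t (Finset.mem_insert_self t s))
      (ih (fun v hv u hu => hreg v (Finset.mem_insert_of_mem hv) u
        (Finset.mem_insert_of_mem hu)) fun v hv => hB v (Finset.mem_insert_of_mem hv))
    · rw [Finset.prod_insert ht]
      constructor
      · intro hx
        refine mem_of_mul_prod_mem (fun u hu => hreg t (Finset.mem_insert_self t s) u
          (Finset.mem_insert_of_mem hu) fun hut => ht (hut ▸ hu)) ?_
        obtain ⟨a, b, hab⟩ := Ideal.mem_span_pair.mp hx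
        exact Ideal.mem_span_pair.mpr ⟨a * ∏ u ∈ s, g u, b, by rw [← hab]; ring⟩
      · intro hx
        obtain ⟨a, b, rfl⟩ := Ideal.mem_span_pair.mp hx
        exact Ideal.mem_span_pair.mpr ⟨a, b * ∏ u ∈ s, g u, by ring⟩
    · rw [Finset.prod_insert ht]
      refine le_antisymm ?_ (sup_le ?_ ?_) <;> simp only [Ideal.span_le, Set.insert_subset_iff,
        Set.singleton_subset_iff, SetLike.mem_coe]
      · exact ⟨Ideal.mem_sup_right (Ideal.mem_span_singleton_self _),
          Ideal.mem_sup_left (Ideal.subset_span (by simp))⟩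
      · exact ⟨Ideal.mul_mem_left _ _ (Ideal.subset_span (by simp)), Ideal.subset_span (by simp)⟩
      · exact Ideal.subset_span (by simp)

end ProductIdeals

/-! ### Pencils of planes and liaison addition. -/

section PairwiseIntersection

variable {R ι : Type*} [CommRing R]

/-- The intersection of the ideals `(ℓ i, ℓ j)` over all pairs of distinct indices in `S`. -/
def pairwiseIdeal (ℓ : ι → R) (S : Finset ι) : Ideal R :=
  ⨅ i ∈ S, ⨅ j ∈ S, ⨅ (_ : i ≠ j), Ideal.span {ℓ i, ℓ j}

variable {ℓ : ι → R}

theorem mem_pairwiseIdeal {S : Finset ι} {x : R} :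
    x ∈ pairwiseIdeal ℓ S ↔ ∀ i ∈ S, ∀ j ∈ S, i ≠ j → x ∈ Ideal.span {ℓ i, ℓ j} := by
  simp only [pairwiseIdeal, Submodule.mem_iInf]

theorem prod_mem_span_pair_left {s : Finset ι} {i : ι} (hi : i ∈ s) (x : R) :
    ∏ u ∈ s, ℓ u ∈ Ideal.span {ℓ i, x} :=
  Ideal.mem_of_dvd _ (Finset.dvd_prod_of_mem ℓ hi) (Ideal.subset_span (by simp))

theorem prod_mem_span_pair_right {s : Finset ι} {i : ι} (hi : i ∈ s) (x : R) :
    ∏ u ∈ s, ℓ u ∈ Ideal.span {x, ℓ i} :=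
  Ideal.mem_of_dvd _ (Finset.dvd_prod_of_mem ℓ hi) (Ideal.subset_span (by simp))

/-- The index sets `T` and `C` are transversal for `ℓ` if the ideals `(ℓ i, ℓ j)` with `i ∈ T` and
`j ∈ C` are prime and contain no `ℓ l` with another index `l` in `T` or `C`. -/
structure IsTransversal (ℓ : ι → R) (T C : Finset ι) : Prop where
  isPrime : ∀ i ∈ T, ∀ j ∈ C, (Ideal.span {ℓ i, ℓ j}).IsPrime
  notMem_left : ∀ i ∈ T, ∀ j ∈ C, ∀ l ∈ T, l ≠ i → ℓ l ∉ Ideal.span {ℓ i, ℓ j}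
  notMem_right : ∀ i ∈ T, ∀ j ∈ C, ∀ l ∈ C, l ≠ j → ℓ l ∉ Ideal.span {ℓ i, ℓ j}

namespace IsTransversal

variable {T C : Finset ι} (h : IsTransversal ℓ T C)
include h

theorem mem_of_mul_mem_left {j : ι} (hj : j ∈ C) :
    ∀ t ∈ T, ∀ u ∈ T, u ≠ t → ∀ b, b * ℓ u ∈ Ideal.span {ℓ t, ℓ j} → b ∈ Ideal.span {ℓ t, ℓ j} :=
  fun t ht u hu hut _ hb =>
    ((h.isPrime t ht j hj).mem_or_mem hb).resolve_right (h.notMem_left t ht j hj u hu hut)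

theorem mem_span_prod_left {j : ι} (hj : j ∈ C) {x : R}
    (hx : ∀ i ∈ T, x ∈ Ideal.span {ℓ i, ℓ j}) : x ∈ Ideal.span {ℓ j, ∏ i ∈ T, ℓ i} :=
  Set.pair_comm (ℓ j) _ ▸ mem_span_pair_prod (h.mem_of_mul_mem_left hj) hx

/-- The ideal `(ℓ t, ∏ ℓ i)` is the intersection of the primes `(ℓ i, ℓ t)`, `i ∈ T`, and none of
them contains `ℓ u`. -/
theorem mem_of_mul_mem_right :
    ∀ t ∈ C, ∀ u ∈ C, u ≠ t → ∀ b, b * ℓ u ∈ Ideal.span {ℓ t, ∏ i ∈ T, ℓ i} →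
      b ∈ Ideal.span {ℓ t, ∏ i ∈ T, ℓ i} := by
  intro t ht u hu hut b hb
  refine h.mem_span_prod_left ht fun i hi => ?_
  have hle : Ideal.span {ℓ t, ∏ i ∈ T, ℓ i} ≤ Ideal.span {ℓ i, ℓ t} := by
    simp only [Ideal.span_le, Set.insert_subset_iff, Set.singleton_subset_iff, SetLike.mem_coe]
    exact ⟨Ideal.subset_span (by simp), prod_mem_span_pair_left hi _⟩
  exact ((h.isPrime i hi t ht).mem_or_mem (hle hb)).resolve_right
    (h.notMem_right i hi t ht u hu hut)

theorem mem_span_prod_prod {x : R} (hx : ∀ i ∈ T, ∀ j ∈ C, x ∈ Ideal.span {ℓ i, ℓ j}) :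
    x ∈ Ideal.span {∏ j ∈ C, ℓ j, ∏ i ∈ T, ℓ i} :=
  mem_span_pair_prod h.mem_of_mul_mem_right fun j hj =>
    h.mem_span_prod_left hj fun i hi => hx i hi j hj

theorem finiteFreeQuotient_span_prod_prod {B : Type*} [CommRing B] [Algebra B R]
    (hB : ∀ i ∈ T, ∀ j ∈ C, FiniteFreeQuotient B (Ideal.span {ℓ i, ℓ j})) :
    FiniteFreeQuotient B (Ideal.span {∏ j ∈ C, ℓ j, ∏ i ∈ T, ℓ i}) :=
  FiniteFreeQuotient.span_pair_prod h.mem_of_mul_mem_right fun j hj => Set.pair_comm (ℓ j) _ ▸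
    FiniteFreeQuotient.span_pair_prod (h.mem_of_mul_mem_left hj) fun i hi => hB i hi j hj

end IsTransversal

/-- The elements `ℓ i` fall into pencils, the classes of the equivalence relation `r`: all pairs in
a pencil generate the same ideal, which contains no element of another pencil, and two elements
of different pencils generate an ideal which contains no third element. -/
structure IsPencilPartition (ℓ : ι → R) (r : ι → ι → Prop) : Prop where
  equivalence : Equivalence r
  isPrime : ∀ i j, i ≠ j → (Ideal.span {ℓ i, ℓ j}).IsPrime
  span_eq : ∀ i j l m, r i j → r i l → r i m → i ≠ j → l ≠ m →
    Ideal.span {ℓ l, ℓ m} = Ideal.span {ℓ i, ℓ j}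
  notMem_of_rel : ∀ i j l, i ≠ j → r i j → ¬ r i l → ℓ l ∉ Ideal.span {ℓ i, ℓ j}
  notMem_of_not_rel : ∀ i j l, ¬ r i j → l ≠ i → l ≠ j → ℓ l ∉ Ideal.span {ℓ i, ℓ j}

namespace IsPencilPartition

variable {r : ι → ι → Prop} (h : IsPencilPartition ℓ r)
include h

theorem isTransversal {T C : Finset ι} (hTC : ∀ i ∈ T, ∀ j ∈ C, ¬ r i j) :
    IsTransversal ℓ T C := by
  have hne : ∀ i ∈ T, ∀ j ∈ C, i ≠ j := by
    rintro i hi _ hj rfl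
    exact hTC i hi i hj (h.equivalence.refl i)
  exact ⟨fun i hi j hj => h.isPrime i j (hne i hi j hj),
    fun i hi j hj l hl hli => h.notMem_of_not_rel i j l (hTC i hi j hj) hli (hne l hl j hj),
    fun i hi j hj l hl hlj => h.notMem_of_not_rel i j l (hTC i hi j hj) (hne i hi l hl).symm hlj⟩

theorem mem_of_mul_prod_mem {C : Finset ι} {i j : ι} (hij : i ≠ j) (hi : ∀ c ∈ C, ¬ r i c)
    (hj : ∀ c ∈ C, ¬ r j c) {x : R} (hx : x * ∏ c ∈ C, ℓ c ∈ Ideal.span {ℓ i, ℓ j}) :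
    x ∈ Ideal.span {ℓ i, ℓ j} := by
  refine _root_.mem_of_mul_prod_mem (fun u hu b hb => ?_) hx
  refine ((h.isPrime i j hij).mem_or_mem hb).resolve_right ?_
  by_cases hr : r i j
  · exact h.notMem_of_rel i j u hij hr (hi u hu)
  · refine h.notMem_of_not_rel i j u hr ?_ ?_
    · rintro rfl
      exact hi u hu (h.equivalence.refl u)
    · rintro rfl
      exact hj u hu (h.equivalence.refl u)

variable {B : Type*} [CommRing B] [Algebra B R]

theorem finiteFreeQuotient_pairwiseIdeal_of_rel
    (hB : ∀ i j, i ≠ j → FiniteFreeQuotient B (Ideal.span {ℓ i, ℓ j})) {C : Finset ι}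
    (hC : ∀ i ∈ C, ∀ j ∈ C, r i j) : FiniteFreeQuotient B (pairwiseIdeal ℓ C) := by
  by_cases hex : ∃ i ∈ C, ∃ j ∈ C, i ≠ j
  · obtain ⟨i, hi, j, hj, hij⟩ := hex
    have : pairwiseIdeal ℓ C = Ideal.span {ℓ i, ℓ j} := by
      ext x
      rw [mem_pairwiseIdeal]
      refine ⟨fun hx => hx i hi j hj hij, fun hx l hl m hm hlm => ?_⟩
      rwa [h.span_eq i j l m (hC i hi j hj) (hC i hi l hl) (hC i hi m hm) hij hlm]
    exact this ▸ hB i j hij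
  · have : pairwiseIdeal ℓ C = ⊤ := by
      rw [eq_top_iff]
      intro x _
      rw [mem_pairwiseIdeal]
      intro i hi j hj hij
      exact absurd ⟨i, hi, j, hj, hij⟩ hex
    exact this ▸ finiteFreeQuotient_top B

/-- Liaison addition: adding a pencil `C` to a union `T` of other pencils. -/
theorem finiteFreeQuotient_pairwiseIdeal_union [DecidableEq ι] {T C : Finset ι}
    (hTC : ∀ i ∈ T, ∀ j ∈ C, ¬ r i j)
    (hB : ∀ i ∈ T, ∀ j ∈ C, FiniteFreeQuotient B (Ideal.span {ℓ i, ℓ j}))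
    (hT : FiniteFreeQuotient B (pairwiseIdeal ℓ T))
    (hC : FiniteFreeQuotient B (pairwiseIdeal ℓ C)) :
    FiniteFreeQuotient B (pairwiseIdeal ℓ (T ∪ C)) := by
  have htr := h.isTransversal hTC
  have hCT : ∀ j ∈ C, ∀ i ∈ T, ¬ r j i := fun j hj i hi hji =>
    hTC i hi j hj (h.equivalence.symm hji)
  have hle : pairwiseIdeal ℓ (T ∪ C) ≤ pairwiseIdeal ℓ C := fun x hx => by
    rw [mem_pairwiseIdeal] at hx ⊢
    exact fun i hi j hj => hx i (Finset.mem_union_right _ hi) j (Finset.mem_union_right _ hj)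
  -- The colon by the product over `C` leaves the lines of `T`. After adding that product, the colon
  -- by the product over `T` leaves the lines of `C`, and the remaining sum is the complete
  -- intersection of the two products, whose lines are the mixed ones.
  refine FiniteFreeQuotient.of_colon (∏ j ∈ C, ℓ j) (fun x => ?_) rfl hT
    (FiniteFreeQuotient.of_colon (∏ i ∈ T, ℓ i) (fun x => ?_) ?_ hC
      (htr.finiteFreeQuotient_span_prod_prod hB))
  · simp only [mem_pairwiseIdeal]
    constructor
    · intro hx i hi j hj hij
      exact h.mem_of_mul_prod_mem hij (hTC i hi) (hTC j hj)
        (hx i (Finset.mem_union_left _ hi) j (Finset.mem_union_left _ hj) hij)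
    · intro hx i hi j hj hij
      rcases Finset.mem_union.mp hi with hi | hi
      · rcases Finset.mem_union.mp hj with hj | hj
        · exact Ideal.mul_mem_right _ _ (hx i hi j hj hij)
        · exact Ideal.mul_mem_left _ _ (prod_mem_span_pair_right hj _)
      · exact Ideal.mul_mem_left _ _ (prod_mem_span_pair_left hi _)
  · constructor
    · intro hx
      have hle' : pairwiseIdeal ℓ (T ∪ C) ⊔ Ideal.span {∏ j ∈ C, ℓ j} ≤ pairwiseIdeal ℓ C := by
        refine sup_le hle ((Ideal.span_singleton_le_iff_mem _).mpr ?_)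
        rw [mem_pairwiseIdeal]
        exact fun i hi j _ _ => prod_mem_span_pair_left hi _
      have hx' := mem_pairwiseIdeal.mp (hle' hx)
      rw [mem_pairwiseIdeal]
      exact fun i hi j hj hij => h.mem_of_mul_prod_mem hij (hCT i hi) (hCT j hj) (hx' i hi j hj hij)
    · intro hx
      refine Ideal.mem_sup_left ?_
      rw [mem_pairwiseIdeal] at hx ⊢
      intro i hi j hj hij
      rcases Finset.mem_union.mp hi with hi | hi
      · exact Ideal.mul_mem_left _ _ (prod_mem_span_pair_left hi _)
      · rcases Finset.mem_union.mp hj with hj | hj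
        · exact Ideal.mul_mem_left _ _ (prod_mem_span_pair_right hj _)
        · exact Ideal.mul_mem_right _ _ (hx i hi j hj hij)
  · refine le_antisymm ?_ (sup_le (sup_le (fun x hx => ?_) ?_) ?_)
    · rw [Ideal.span_insert]
      exact sup_le_sup_right le_sup_right _
    · rw [mem_pairwiseIdeal] at hx
      refine htr.mem_span_prod_prod fun i hi j hj =>
        hx i (Finset.mem_union_left _ hi) j (Finset.mem_union_right _ hj) ?_
      rintro rfl
      exact hTC i hi i hj (h.equivalence.refl i)
    · exact Ideal.span_mono (by simp)
    · exact Ideal.span_mono (by simp)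

/-- Strong induction, removing the whole pencil of one chosen plane at each step. -/
theorem finiteFreeQuotient_pairwiseIdeal
    (hB : ∀ i j, i ≠ j → FiniteFreeQuotient B (Ideal.span {ℓ i, ℓ j})) (S : Finset ι) :
    FiniteFreeQuotient B (pairwiseIdeal ℓ S) := by
  classical
  induction S using Finset.strongInduction with
  | H S ih =>
  rcases S.eq_empty_or_nonempty with rfl | ⟨i₀, hi₀⟩
  · exact h.finiteFreeQuotient_pairwiseIdeal_of_rel hB (by simp)
  have hTC : ∀ i ∈ S.filter (fun i => ¬ r i₀ i), ∀ j ∈ S.filter (r i₀), ¬ r i j := by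
    intro i hi j hj hij
    exact (Finset.mem_filter.mp hi).2
      (h.equivalence.trans (Finset.mem_filter.mp hj).2 (h.equivalence.symm hij))
  rw [← Finset.filter_union_filter_not_eq (r i₀) S, Finset.union_comm]
  refine h.finiteFreeQuotient_pairwiseIdeal_union hTC (fun i hi j hj => hB i j ?_) (ih _ ?_)
    (h.finiteFreeQuotient_pairwiseIdeal_of_rel hB ?_)
  · rintro rfl
    exact hTC i hi i hj (h.equivalence.refl i)
  · exact Finset.filter_ssubset.mpr ⟨i₀, hi₀, not_not.mpr (h.equivalence.refl i₀)⟩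
  · intro i hi j hj
    exact h.equivalence.trans (h.equivalence.symm (Finset.mem_filter.mp hi).2)
      (Finset.mem_filter.mp hj).2

end IsPencilPartition

end PairwiseIntersection

/-! ### Linear forms and generic choices. -/

theorem exists_forall_linearIndependent_cons {k V J : Type*} [Field k] [Infinite k]
    [AddCommGroup V] [Module k V] [FiniteDimensional k V] [Finite J] {n : ℕ}
    (hn : n < Module.finrank k V) (u : J → Fin n → V) (hu : ∀ j, LinearIndependent k (u j)) :
    ∃ z, ∀ j, LinearIndependent k (Fin.cons z (u j) : Fin (n + 1) → V) := by
  by_contra! hcon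
  -- Over an infinite field finitely many proper subspaces do not cover `V`; here each is spanned by
  -- `n < dim V` vectors.
  obtain ⟨j, hj⟩ := Subspace.exists_eq_top_of_iUnion_eq_univ
    (p := fun j => Submodule.span k (Set.range (u j))) (Set.eq_univ_of_forall fun z => by
      obtain ⟨j, hj⟩ := hcon z
      refine Set.mem_iUnion.mpr ⟨j, ?_⟩
      by_contra hz
      exact hj (linearIndependent_finCons.mpr ⟨hu j, hz⟩))
  have := finrank_range_le_card (R := k) (b := u j)
  rw [Set.finrank, hj, finrank_top, Fintype.card_fin] at this
  omega

section LinearForms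

variable {k σ : Type*} [Field k] [Fintype σ]

variable (k σ) in
/-- The linear form with given coefficients. -/
noncomputable def linearForm : (σ → k) →ₗ[k] MvPolynomial σ k :=
  Fintype.linearCombination k X

theorem linearForm_apply (v : σ → k) : linearForm k σ v = ∑ t, v t • X t := rfl

theorem linearForm_single [DecidableEq σ] (t : σ) : linearForm k σ (Pi.single t 1) = X t := by
  simp [linearForm]

theorem exists_linearForm_eq {p : MvPolynomial σ k} (hp : p.IsHomogeneous 1) :
    ∃ v, linearForm k σ v = p := by
  have h0 : ∀ t, ∃ c, pderiv t p = C c := fun t =>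
    ⟨_, totalDegree_eq_zero_iff_eq_C.mp (Nat.le_zero.mp (hp.pderiv.totalDegree_le))⟩
  choose c hc using h0
  refine ⟨c, ?_⟩
  rw [← one_nsmul p, ← hp.sum_X_mul_pderiv, linearForm_apply]
  exact Finset.sum_congr rfl fun t _ => by rw [hc, smul_eq_C_mul, mul_comm]

theorem pderiv_linearForm (v : σ → k) (t : σ) : pderiv t (linearForm k σ v) = C (v t) := by
  classical
  simp [linearForm_apply, pderiv_X, Pi.single_apply, smul_eq_C_mul]

/-- The algebra homomorphism from a polynomial ring given by a linear map on the linear forms. -/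
noncomputable def linearFormLift {A : Type*} [CommRing A] [Algebra k A] (ψ : (σ → k) →ₗ[k] A) :
    MvPolynomial σ k →ₐ[k] A := by
  classical exact aeval fun t => ψ (Pi.single t 1)

theorem linearFormLift_linearForm {A : Type*} [CommRing A] [Algebra k A] (ψ : (σ → k) →ₗ[k] A)
    (v : σ → k) : linearFormLift ψ (linearForm k σ v) = ψ v := by
  classical
  have : (linearFormLift ψ).toLinearMap ∘ₗ linearForm k σ = ψ := by
    refine LinearMap.pi_ext' fun t => LinearMap.ext_ring ?_
    simp [linearForm_single, linearFormLift]
  exact LinearMap.congr_fun this v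

theorem linearForm_algHom_ext {A : Type*} [CommRing A] [Algebra k A]
    {f g : MvPolynomial σ k →ₐ[k] A}
    (h : ∀ v, f (linearForm k σ v) = g (linearForm k σ v)) : f = g := by
  classical
  exact MvPolynomial.algHom_ext fun t => by simpa [linearForm_single] using h (Pi.single t 1)

end LinearForms

/-! ### The coordinate ring of a line, as a polynomial ring in two complementary forms. -/

section Retraction

variable {k : Type*} [Field k] {y z u w : Fin 4 → k}

/-- The polynomial ring on two linear forms. -/
noncomputable def planeInclusion (y z : Fin 4 → k) :
    MvPolynomial (Fin 2) k →ₐ[k] MvPolynomial (Fin 4) k :=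
  aeval ![linearForm k (Fin 4) y, linearForm k (Fin 4) z]

/-- In the basis `y, z, u, w` of linear forms, `φ` sets `u = w = 0`. This identifies the quotient by
`(u, w)` with `k[y, z]`; primality and freeness of rank one are read off from it. -/
theorem exists_retraction (h : LinearIndependent k ![y, z, u, w]) :
    ∃ φ : MvPolynomial (Fin 4) k →ₐ[k] MvPolynomial (Fin 2) k,
      φ (linearForm k (Fin 4) y) = X 0 ∧
      (∀ b, φ (planeInclusion y z b) = b) ∧
      RingHom.ker φ = Ideal.span {linearForm k (Fin 4) u, linearForm k (Fin 4) w} ∧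
      ∀ r, r - planeInclusion y z (φ r) ∈
        Ideal.span {linearForm k (Fin 4) u, linearForm k (Fin 4) w} := by
  let b := basisOfLinearIndependentOfCardEqFinrank h (by simp)
  have hb : ⇑b = ![y, z, u, w] := coe_basisOfLinearIndependentOfCardEqFinrank h _
  let ψ : (Fin 4 → k) →ₗ[k] MvPolynomial (Fin 2) k := b.constr k ![X 0, X 1, 0, 0]
  have hψ : ∀ i, ψ (![y, z, u, w] i) = (![X 0, X 1, 0, 0] : Fin 4 → MvPolynomial (Fin 2) k) i :=
    fun i => by rw [← hb]; exact b.constr_basis k _ i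
  set I := Ideal.span {linearForm k (Fin 4) u, linearForm k (Fin 4) w}
  let φ := linearFormLift ψ
  have hy : φ (linearForm k (Fin 4) y) = X 0 := (linearFormLift_linearForm ψ y).trans (hψ 0)
  have hz : φ (linearForm k (Fin 4) z) = X 1 := (linearFormLift_linearForm ψ z).trans (hψ 1)
  have hu : φ (linearForm k (Fin 4) u) = 0 := (linearFormLift_linearForm ψ u).trans (hψ 2)
  have hw : φ (linearForm k (Fin 4) w) = 0 := (linearFormLift_linearForm ψ w).trans (hψ 3)
  have hsub : ∀ r, r - planeInclusion y z (φ r) ∈ I := by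
    have hcomp : ((Ideal.Quotient.mkₐ k I).comp (planeInclusion y z)).comp φ =
        Ideal.Quotient.mkₐ k I := by
      refine linearForm_algHom_ext fun v => ?_
      suffices (((Ideal.Quotient.mkₐ k I).comp (planeInclusion y z)).comp φ).toLinearMap ∘ₗ
          linearForm k (Fin 4) = (Ideal.Quotient.mkₐ k I).toLinearMap ∘ₗ linearForm k (Fin 4) from
        LinearMap.congr_fun this v
      have hmu : Ideal.Quotient.mk I (linearForm k (Fin 4) u) = 0 :=
        Ideal.Quotient.eq_zero_iff_mem.mpr (Ideal.subset_span (by simp))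
      have hmw : Ideal.Quotient.mk I (linearForm k (Fin 4) w) = 0 :=
        Ideal.Quotient.eq_zero_iff_mem.mpr (Ideal.subset_span (by simp))
      refine b.ext fun i => ?_
      rw [hb]
      fin_cases i
      · simp [hy, planeInclusion]
      · simp [hz, planeInclusion]
      · simp [hu, hmu]
      · simp [hw, hmw]
    intro r
    rw [← Ideal.Quotient.eq]
    exact (AlgHom.congr_fun hcomp r).symm
  refine ⟨φ, hy, fun b => ?_, le_antisymm (fun r hr => ?_) ?_, hsub⟩
  · have : φ.comp (planeInclusion y z) = AlgHom.id k _ := by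
      refine MvPolynomial.algHom_ext fun i => ?_
      fin_cases i
      · simp [hy, planeInclusion]
      · simp [hz, planeInclusion]
    exact AlgHom.congr_fun this b
  · have := hsub r
    rwa [(RingHom.mem_ker).mp hr, map_zero, sub_zero] at this
  · rw [Ideal.span_le]
    rintro _ (rfl | rfl)
    exacts [hu, hw]

theorem isPrime_span_linearForm (h : LinearIndependent k ![y, z, u, w]) :
    (Ideal.span {linearForm k (Fin 4) u, linearForm k (Fin 4) w}).IsPrime := by
  obtain ⟨φ, -, -, hker, -⟩ := exists_retraction h
  exact hker ▸ RingHom.ker_isPrime φ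

theorem linearForm_notMem_span (h : LinearIndependent k ![y, z, u, w]) :
    linearForm k (Fin 4) y ∉
      Ideal.span {linearForm k (Fin 4) u, linearForm k (Fin 4) w} := by
  obtain ⟨φ, hy, -, hker, -⟩ := exists_retraction h
  rw [← hker, RingHom.mem_ker, hy]
  exact X_ne_zero 0

theorem finiteFreeQuotient_span_linearForm
    [Algebra (MvPolynomial (Fin 2) k) (MvPolynomial (Fin 4) k)]
    (halg : ∀ b, algebraMap (MvPolynomial (Fin 2) k) (MvPolynomial (Fin 4) k) b =
      planeInclusion y z b) (h : LinearIndependent k ![y, z, u, w]) :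
    FiniteFreeQuotient (MvPolynomial (Fin 2) k)
      (Ideal.span {linearForm k (Fin 4) u, linearForm k (Fin 4) w}) := by
  obtain ⟨φ, -, hφ, hker, hsub⟩ := exists_retraction h
  refine finiteFreeQuotient_of_bijective _ ⟨?_, fun a => ?_⟩
  · rw [injective_iff_map_eq_zero]
    intro b hb
    have hb' : planeInclusion y z b ∈
        Ideal.span {linearForm k (Fin 4) u, linearForm k (Fin 4) w} := by
      rw [← halg]
      exact Ideal.Quotient.eq_zero_iff_mem.mp hb
    rwa [← hker, RingHom.mem_ker, hφ] at hb'
  · obtain ⟨r, rfl⟩ := Ideal.Quotient.mk_surjective a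
    refine ⟨φ r, ?_⟩
    have := hsub r
    rw [← halg, ← Ideal.Quotient.eq] at this
    exact this.symm

theorem isHomogeneous_linearForm {σ : Type*} [Fintype σ] (v : σ → k) :
    (linearForm k σ v).IsHomogeneous 1 := by
  rw [linearForm_apply]
  refine IsHomogeneous.sum _ _ _ fun t _ => ?_
  rw [smul_eq_C_mul]
  simpa using (isHomogeneous_C σ (v t)).mul (isHomogeneous_X k t)

theorem linearForm_ne_zero {σ : Type*} [Fintype σ] {v : σ → k} (hv : v ≠ 0) :
    linearForm k σ v ≠ 0 := by
  obtain ⟨t, ht⟩ := Function.ne_iff.mp hv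
  intro h
  have := pderiv_linearForm v t
  rw [h, map_zero, eq_comm, C_eq_zero] at this
  exact ht this

theorem prime_linearForm {σ : Type*} [Fintype σ] {v : σ → k} (hv : v ≠ 0) :
    Prime (linearForm k σ v) := by
  have hne := linearForm_ne_zero hv
  refine (irreducible_of_totalDegree_eq_one
    ((isHomogeneous_linearForm v).totalDegree hne) fun x hx => ?_).prime
  obtain ⟨m, hm⟩ := MvPolynomial.ne_zero_iff.mp hne
  exact (ne_zero_of_dvd_ne_zero hm (hx m)).isUnit

theorem height_span_linearForm (h : LinearIndependent k ![y, z, u, w]) :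
    (Ideal.span {linearForm k (Fin 4) u, linearForm k (Fin 4) w}).height = 2 := by
  classical
  have hP := isPrime_span_linearForm h
  -- Exchanging `y` and `w` gives `w ∉ (u, y)`, so the chain `0 < (u) < (u, w)` is strict.
  have h' : LinearIndependent k ![w, z, u, y] := by
    have hinj : Function.Injective (![3, 1, 2, 0] : Fin 4 → Fin 4) := by decide
    convert! h.comp _ hinj using 1
    ext i t
    fin_cases i <;> rfl
  have hu : u ≠ 0 := h.ne_zero 2
  have hprime : (Ideal.span {linearForm k (Fin 4) u}).IsPrime :=
    (Ideal.span_singleton_prime (linearForm_ne_zero hu)).mpr (prime_linearForm hu)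
  refine le_antisymm ?_ ?_
  · have hmin : Ideal.span {linearForm k (Fin 4) u, linearForm k (Fin 4) w} ∈
        (Ideal.span (({linearForm k (Fin 4) u, linearForm k (Fin 4) w} :
          Finset (MvPolynomial (Fin 4) k)) : Set (MvPolynomial (Fin 4) k))).minimalPrimes := by
      rw [Finset.coe_pair, Ideal.minimalPrimes_eq_subsingleton_self]
      exact Set.mem_singleton _
    refine (Ideal.height_le_card_of_mem_minimalPrimes_span_finset hmin).trans ?_
    exact_mod_cast Finset.card_le_two
  · have h1 : (⊥ : Ideal (MvPolynomial (Fin 4) k)) < Ideal.span {linearForm k (Fin 4) u} :=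
      bot_lt_iff_ne_bot.mpr (by
        rw [Ne, Ideal.span_singleton_eq_bot]
        exact linearForm_ne_zero hu)
    have h2 : Ideal.span {linearForm k (Fin 4) u} <
        Ideal.span {linearForm k (Fin 4) u, linearForm k (Fin 4) w} := by
      refine lt_of_le_of_ne (Ideal.span_mono (by simp)) fun heq => ?_
      have hw : linearForm k (Fin 4) w ∈
          Ideal.span {linearForm k (Fin 4) u, linearForm k (Fin 4) w} :=
        Ideal.subset_span (by simp)
      rw [← heq] at hw
      exact linearForm_notMem_span h' (Ideal.span_mono (by simp) hw)
    calc (2 : ℕ∞) = 0 + 1 + 1 := by norm_num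
      _ ≤ (⊥ : Ideal (MvPolynomial (Fin 4) k)).height + 1 + 1 := by gcongr; exact zero_le
      _ ≤ (Ideal.span {linearForm k (Fin 4) u}).height + 1 := by
        gcongr
        exact Ideal.height_add_one_le_of_lt_of_isPrime h1
      _ ≤ _ := Ideal.height_add_one_le_of_lt_of_isPrime h2

end Retraction

/-! ### The Jacobian ideal, its radical and its non-reduced components. -/

section Jacobian

variable {k σ ι : Type*} [Field k] [Fintype ι] {ℓ : ι → MvPolynomial σ k}

theorem jacobianIdeal_prod_le_span_pair {i j : ι} (hij : i ≠ j) :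
    jacobianIdeal (∏ i, ℓ i) ≤ Ideal.span {ℓ i, ℓ j} := by
  classical
  rw [jacobianIdeal, Ideal.span_le]
  rintro _ ⟨t, rfl⟩
  rw [SetLike.mem_coe]
  dsimp only
  rw [← Finset.mul_prod_erase _ _ (Finset.mem_univ i), pderiv_mul]
  exact add_mem (Ideal.mul_mem_left _ _ (prod_mem_span_pair_right (by simp [hij.symm]) _))
    (Ideal.mul_mem_right _ _ (Ideal.subset_span (by simp)))

/-- Differentiating a product removes at most one of three factors in `P`, so two remain in every
term. -/
theorem jacobianIdeal_prod_le_sq {P : Ideal (MvPolynomial σ k)} {i j l : ι} (hij : i ≠ j)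
    (hil : i ≠ l) (hjl : j ≠ l) (hi : ℓ i ∈ P) (hj : ℓ j ∈ P) (hl : ℓ l ∈ P) :
    jacobianIdeal (∏ i, ℓ i) ≤ P ^ 2 := by
  classical
  rw [jacobianIdeal, Ideal.span_le]
  rintro _ ⟨t, rfl⟩
  rw [SetLike.mem_coe]
  dsimp only
  rw [← Finset.mul_prod_erase _ _ (Finset.mem_univ i),
    ← Finset.mul_prod_erase _ _ (show j ∈ Finset.univ.erase i by simp [hij.symm]),
    ← Finset.mul_prod_erase _ _
      (show l ∈ (Finset.univ.erase i).erase j by simp [hil.symm, hjl.symm])]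
  generalize ∏ u ∈ ((Finset.univ.erase i).erase j).erase l, ℓ u = H
  have hmul : ∀ a b, a ∈ P → b ∈ P → ∀ c, c * (a * b) ∈ P ^ 2 := fun a b ha hb c =>
    Ideal.mul_mem_left _ _ (pow_two P ▸ Ideal.mul_mem_mul ha hb)
  have key : pderiv t (ℓ i * (ℓ j * (ℓ l * H))) =
      (pderiv t (ℓ i) * H) * (ℓ j * ℓ l) + (pderiv t (ℓ j) * H) * (ℓ i * ℓ l) +
        pderiv t (ℓ l * H) * (ℓ i * ℓ j) := by
    simp only [pderiv_mul]
    ring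
  rw [key]
  exact add_mem (add_mem (hmul _ _ hj hl _) (hmul _ _ hi hl _)) (hmul _ _ hi hj _)

theorem exists_pderiv_eq_C {p : MvPolynomial σ k} [Fintype σ] (hp : p.IsHomogeneous 1)
    (hne : p ≠ 0) : ∃ t c, c ≠ 0 ∧ pderiv t p = C c := by
  obtain ⟨v, rfl⟩ := exists_linearForm_eq hp
  have hv : v ≠ 0 := by
    rintro rfl
    exact hne (map_zero _)
  obtain ⟨t, ht⟩ := Function.ne_iff.mp hv
  exact ⟨t, v t, ht, pderiv_linearForm v t⟩

theorem mem_of_C_mul_mem {P : Ideal (MvPolynomial σ k)} {c : k} (hc : c ≠ 0)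
    {x : MvPolynomial σ k} (hx : C c * x ∈ P) : x ∈ P := by
  have := P.mul_mem_left (C c⁻¹) hx
  rwa [← mul_assoc, ← C_mul, inv_mul_cancel₀ hc, C_1, one_mul] at this

/-- A singular point of a plane arrangement lies on two of its planes. -/
theorem exists_ne_mem_of_jacobianIdeal_le [Fintype σ] [CharZero k] [Nonempty ι]
    (hlin : ∀ i, (ℓ i).IsHomogeneous 1) (hne : ∀ i, ℓ i ≠ 0) {P : Ideal (MvPolynomial σ k)}
    [hP : P.IsPrime] (hJ : jacobianIdeal (∏ i, ℓ i) ≤ P) : ∃ i j, i ≠ j ∧ ℓ i ∈ P ∧ ℓ j ∈ P := by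
  classical
  have hD : ∀ t, pderiv t (∏ i, ℓ i) ∈ P := fun t => hJ (Ideal.subset_span ⟨t, rfl⟩)
  have hF : ∏ i, ℓ i ∈ P := by
    have hhom : (∏ i, ℓ i).IsHomogeneous (∑ _i : ι, 1) :=
      IsHomogeneous.prod _ _ _ fun i _ => hlin i
    have hE := hhom.sum_X_mul_pderiv
    rw [nsmul_eq_mul, ← C_eq_coe_nat] at hE
    -- Euler's formula puts `d * F` in `P`; the degree `d` is positive, hence invertible in
    -- characteristic zero.
    refine mem_of_C_mul_mem (c := ((∑ _i : ι, 1 : ℕ) : k)) (by simp) ?_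
    rw [← hE]
    exact sum_mem fun t _ => Ideal.mul_mem_left _ _ (hD t)
  obtain ⟨i, -, hi⟩ := hP.prod_mem_iff.mp hF
  obtain ⟨t, c, hc, hct⟩ := exists_pderiv_eq_C (hlin i) (hne i)
  have h1 := hD t
  -- Modulo `ℓ i`, the derivative is a nonzero constant times the product of the other forms.
  rw [← Finset.mul_prod_erase _ _ (Finset.mem_univ i), pderiv_mul, hct,
    Ideal.add_mem_iff_left _ (Ideal.mul_mem_right _ _ hi)] at h1
  obtain ⟨j, hj, hjP⟩ := hP.prod_mem_iff.mp (mem_of_C_mul_mem hc h1)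
  exact ⟨i, j, (Finset.ne_of_mem_erase hj).symm, hi, hjP⟩

theorem radical_jacobianIdeal_prod [Fintype σ] [CharZero k] [Nonempty ι]
    (hlin : ∀ i, (ℓ i).IsHomogeneous 1) (hne : ∀ i, ℓ i ≠ 0)
    (hP : ∀ i j, i ≠ j → (Ideal.span {ℓ i, ℓ j}).IsPrime) :
    (jacobianIdeal (∏ i, ℓ i)).radical = pairwiseIdeal ℓ Finset.univ := by
  refine le_antisymm (fun x hx => ?_) ?_
  · rw [mem_pairwiseIdeal]
    intro i _ j _ hij
    exact (hP i j hij).radical_le_iff.mpr (jacobianIdeal_prod_le_span_pair hij) hx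
  · rw [Ideal.radical_eq_sInf]
    refine le_sInf fun P ⟨hJ, hprime⟩ x hx => ?_
    obtain ⟨i, j, hij, hi, hj⟩ := exists_ne_mem_of_jacobianIdeal_le hlin hne hJ
    rw [mem_pairwiseIdeal] at hx
    refine (Ideal.span_le.mpr ?_) (hx i (Finset.mem_univ i) j (Finset.mem_univ j) hij)
    rintro _ (rfl | rfl)
    exacts [hi, hj]

theorem pderiv_mem_of_mem_sq {P : Ideal (MvPolynomial σ k)} (t : σ) {x : MvPolynomial σ k}
    (hx : x ∈ P ^ 2) : pderiv t x ∈ P := by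
  rw [pow_two] at hx
  refine Submodule.mul_induction_on hx (fun a ha b hb => ?_) fun a b ha hb => ?_
  · rw [pderiv_mul]
    exact add_mem (Ideal.mul_mem_left _ _ hb) (Ideal.mul_mem_right _ _ ha)
  · rw [map_add]
    exact add_mem ha hb

/-- The component of `J` at a minimal prime `P` of height two is not radical if `J ≤ P ^ 2`. -/
theorem exists_isNonreducedTopComponent [Fintype σ] {J P : Ideal (MvPolynomial σ k)}
    (hP : P ∈ J.minimalPrimes) (hheight : P.height = 2) (hJ : J ≤ P ^ 2) {u : MvPolynomial σ k}
    (huP : u ∈ P) (hu : u.IsHomogeneous 1) (hne : u ≠ 0) :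
    ∃ q, IsNonreducedTopComponent J q ∧ q.radical = P := by
  classical
  have hprime : P.IsPrime := hP.1.1
  obtain ⟨s, hs⟩ := Submodule.IsLasker.exists_isMinimalPrimaryDecomposition
    (Submodule.isLasker (MvPolynomial σ k) (MvPolynomial σ k)) J
  obtain ⟨q, hq, hqP⟩ := Ideal.IsMinimalPrimaryDecomposition.minimalPrimes_subset_image_radical hs hP
  refine ⟨q, ⟨s, hs, hq, ?_, fun hrad => ?_⟩, hqP⟩
  · rw [← hheight, ← hqP]
    simp only [Ideal.height, Ideal.radical_minimalPrimes]
  · obtain rfl : q = P := hrad.radical.symm.trans hqP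
    -- If `q = P`, then any `x` in the other components satisfies `x * u ∈ J ≤ P ^ 2`.
    -- Differentiating in a direction where `u` has nonzero derivative gives `x ∈ P`, so `P` would
    -- be redundant.
    refine hs.minimal hq fun x hx => ?_
    have hxJ : x * u ∈ J := by
      rw [← hs.inf_eq, ← Finset.insert_erase hq, Finset.inf_insert]
      exact ⟨Ideal.mul_mem_left _ _ huP, Ideal.mul_mem_right _ _ hx⟩
    obtain ⟨t, c, hc, hct⟩ := exists_pderiv_eq_C hu hne
    have h1 := pderiv_mem_of_mem_sq t (hJ hxJ)
    rw [pderiv_mul, hct, Ideal.add_mem_iff_right _ (Ideal.mul_mem_left _ _ huP), mul_comm] at h1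
    exact mem_of_C_mul_mem hc h1

theorem span_pair_mem_minimalPrimes [Fintype σ] [CharZero k]
    (hlin : ∀ i, (ℓ i).IsHomogeneous 1) (hne : ∀ i, ℓ i ≠ 0)
    (hP : ∀ i j, i ≠ j → (Ideal.span {ℓ i, ℓ j}).IsPrime)
    (heq : ∀ i j l m, i ≠ j → l ≠ m → Ideal.span {ℓ l, ℓ m} ≤ Ideal.span {ℓ i, ℓ j} →
      Ideal.span {ℓ l, ℓ m} = Ideal.span {ℓ i, ℓ j}) {i j : ι} (hij : i ≠ j) :
    Ideal.span {ℓ i, ℓ j} ∈ (jacobianIdeal (∏ i, ℓ i)).minimalPrimes := by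
  refine ⟨⟨hP i j hij, jacobianIdeal_prod_le_span_pair hij⟩, fun Q ⟨hQ, hJ⟩ hle => ?_⟩
  have : Nonempty ι := ⟨i⟩
  obtain ⟨l, m, hlm, hl, hm⟩ := exists_ne_mem_of_jacobianIdeal_le hlin hne hJ
  have hlmQ : Ideal.span {ℓ l, ℓ m} ≤ Q := by
    rw [Ideal.span_le]
    rintro _ (rfl | rfl)
    exacts [hl, hm]
  exact (heq i j l m hij hlm (hlmQ.trans hle)).symm.trans_le hlmQ

end Jacobian

/-! ### The partition into pencils. -/

section Partition

variable {R ι : Type*} [CommRing R] {ℓ : ι → R}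

theorem span_pair_le {I : Ideal R} {a b : R} (ha : a ∈ I) (hb : b ∈ I) :
    Ideal.span {a, b} ≤ I := by
  rw [Ideal.span_le]
  rintro _ (rfl | rfl)
  exacts [ha, hb]

/-- Two indices are related if they are equal or a third `ℓ l` lies in the ideal they generate. -/
def InCommonPencil (ℓ : ι → R) (i j : ι) : Prop :=
  i = j ∨ ∃ l, l ≠ i ∧ l ≠ j ∧ ℓ l ∈ Ideal.span {ℓ i, ℓ j}

theorem isPencilPartition_inCommonPencil
    (hP : ∀ i j, i ≠ j → (Ideal.span {ℓ i, ℓ j}).IsPrime)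
    (heq : ∀ i j l m, i ≠ j → l ≠ m → Ideal.span {ℓ l, ℓ m} ≤ Ideal.span {ℓ i, ℓ j} →
      Ideal.span {ℓ l, ℓ m} = Ideal.span {ℓ i, ℓ j})
    (huniq : ∀ a i j l m, i ≠ j → l ≠ m → InCommonPencil ℓ i j → InCommonPencil ℓ l m →
      ℓ a ∈ Ideal.span {ℓ i, ℓ j} → ℓ a ∈ Ideal.span {ℓ l, ℓ m} →
      Ideal.span {ℓ i, ℓ j} = Ideal.span {ℓ l, ℓ m}) :
    IsPencilPartition ℓ (InCommonPencil ℓ) := by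
  have left : ∀ i j, ℓ i ∈ Ideal.span {ℓ i, ℓ j} := fun i j => Ideal.subset_span (by simp)
  have right : ∀ i j, ℓ j ∈ Ideal.span {ℓ i, ℓ j} := fun i j => Ideal.subset_span (by simp)
  have mem_of_rel : ∀ i j l, i ≠ j → InCommonPencil ℓ i j → InCommonPencil ℓ i l →
      ℓ l ∈ Ideal.span {ℓ i, ℓ j} := by
    intro i j l hij hr hr'
    by_cases hil : i = l
    · exact hil ▸ left i j
    · exact huniq i i l i j hil hij hr' hr (left i l) (left i j) ▸ right i l
  refine ⟨⟨fun i => Or.inl rfl, ?_, ?_⟩, hP, ?_, ?_, ?_⟩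
  · rintro i j (rfl | ⟨l, hli, hlj, hl⟩)
    · exact Or.inl rfl
    · exact Or.inr ⟨l, hlj, hli, Set.pair_comm (ℓ i) _ ▸ hl⟩
  · intro i j m hij hjm
    by_cases h1 : i = j
    · exact h1 ▸ hjm
    by_cases h2 : j = m
    · exact h2 ▸ hij
    by_cases h3 : i = m
    · exact Or.inl h3
    -- Transitivity: `ℓ j` lies on only one multiple line, so the lines of `i, j` and of `j, m`
    -- coincide.
    have h := huniq j i j j m h1 h2 hij hjm (right i j) (left j m)
    have h' := heq i j i m h1 h3 (span_pair_le (left i j) (h ▸ right j m))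
    exact Or.inr ⟨j, Ne.symm h1, h2, h' ▸ right i j⟩
  · intro i j l m hr hrl hrm hij hlm
    exact heq i j l m hij hlm
      (span_pair_le (mem_of_rel i j l hij hr hrl) (mem_of_rel i j m hij hr hrm))
  · intro i j l hij hr hrl hl
    have hil : i ≠ l := fun h => hrl (Or.inl h)
    have hjl : j ≠ l := fun h => hrl (h ▸ hr)
    have h := heq i j i l hij hil (span_pair_le (left i j) hl)
    exact hrl (Or.inr ⟨j, hij.symm, hjl, h ▸ right i j⟩)
  · intro i j l hr hli hlj hl
    exact hr (Or.inr ⟨l, hli, hlj, hl⟩)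

end Partition

/-! ### Saturation and assembly of the proof. -/

section Saturation

variable {k σ : Type*} [Field k]

theorem saturation_eq_self {I : Ideal (MvPolynomial σ k)} {y : MvPolynomial σ k}
    (hy : y ∈ Ideal.span (Set.range (X : σ → MvPolynomial σ k)))
    (hI : ∀ (n : ℕ) (x), x * y ^ n ∈ I → x ∈ I) : saturation I = I := by
  refine le_antisymm (iSup_le fun n x hx => ?_) (le_iSup_of_le 0 Ideal.le_colon)
  exact hI n x (Submodule.mem_colon.mp hx _ (Ideal.pow_mem_pow hy n))

theorem linearForm_mem_span_range_X [Fintype σ] (v : σ → k) :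
    linearForm k σ v ∈ Ideal.span (Set.range (X : σ → MvPolynomial σ k)) := by
  rw [linearForm_apply]
  refine sum_mem fun t _ => ?_
  rw [smul_eq_C_mul]
  exact Ideal.mul_mem_left _ _ (Ideal.subset_span ⟨t, rfl⟩)

end Saturation

theorem exists_complementary_forms {k ι : Type*} [Field k] [Infinite k] [Finite ι]
    {v : ι → Fin 4 → k} (hv : ∀ i j, i ≠ j → LinearIndependent k ![v i, v j]) :
    ∃ y z, ∀ i j, i ≠ j → LinearIndependent k ![y, z, v i, v j] := by
  obtain ⟨z, hz⟩ := exists_forall_linearIndependent_cons (k := k) (n := 2) (by simp)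
    (fun p : {p : ι × ι // p.1 ≠ p.2} => ![v p.1.1, v p.1.2]) fun p => hv _ _ p.2
  obtain ⟨y, hy⟩ := exists_forall_linearIndependent_cons (k := k) (n := 3) (by simp)
    (fun p : {p : ι × ι // p.1 ≠ p.2} => ![z, v p.1.1, v p.1.2]) fun p => hz p
  exact ⟨y, z, fun i j hij => hy ⟨(i, j), hij⟩⟩

theorem isCohenMacaulayRing_of_finiteFreeQuotient {k R : Type*} [Field k] {n : ℕ} [CommRing R]
    [Algebra (MvPolynomial (Fin n) k) R] {I : Ideal R}
    (h : FiniteFreeQuotient (MvPolynomial (Fin n) k) I) : IsCohenMacaulayRing (R ⧸ I) := by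
  obtain ⟨_, _⟩ := h
  exact isCohenMacaulayRing_of_finite_free k n _

theorem radical_jacobianIdeal_prod_of_isEmpty {k σ ι : Type*} [Field k] [Fintype ι] [IsEmpty ι]
    (ℓ : ι → MvPolynomial σ k) : (jacobianIdeal (∏ i, ℓ i)).radical = ⊥ := by
  have : jacobianIdeal (∏ i, ℓ i) = ⊥ := by
    rw [jacobianIdeal, Ideal.span_eq_bot]
    rintro _ ⟨t, rfl⟩
    simp
  rw [this]
  exact Ideal.isPrime_bot.radical

/-- The planes of the arrangement fall into pencils if no plane contains the supports of two
non-reduced components. -/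
theorem isPencilPartition_of_unique_nonreduced {k ι : Type*} [Field k] [CharZero k] [Fintype ι]
    {v : ι → Fin 4 → k} {y z : Fin 4 → k}
    (hyz : ∀ i j, i ≠ j → LinearIndependent k ![y, z, v i, v j])
    (hne : ∀ i, v i ≠ 0)
    (hplane : ∀ i, ∀ q q' : Ideal (MvPolynomial (Fin 4) k),
      IsNonreducedTopComponent (jacobianIdeal (∏ i, linearForm k (Fin 4) (v i))) q →
      IsNonreducedTopComponent (jacobianIdeal (∏ i, linearForm k (Fin 4) (v i))) q' →
      linearForm k (Fin 4) (v i) ∈ q.radical → linearForm k (Fin 4) (v i) ∈ q'.radical → q = q') :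
    IsPencilPartition (fun i => linearForm k (Fin 4) (v i))
      (InCommonPencil fun i => linearForm k (Fin 4) (v i)) := by
  set ℓ : ι → MvPolynomial (Fin 4) k := fun i => linearForm k (Fin 4) (v i)
  have hlin : ∀ i, (ℓ i).IsHomogeneous 1 := fun i => isHomogeneous_linearForm _
  have hne' : ∀ i, ℓ i ≠ 0 := fun i => linearForm_ne_zero (hne i)
  have hP : ∀ i j, i ≠ j → (Ideal.span {ℓ i, ℓ j}).IsPrime := fun i j hij =>
    isPrime_span_linearForm (hyz i j hij)
  have hheight : ∀ i j, i ≠ j → (Ideal.span {ℓ i, ℓ j}).height = 2 := fun i j hij =>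
    height_span_linearForm (hyz i j hij)
  have heq : ∀ i j l m, i ≠ j → l ≠ m → Ideal.span {ℓ l, ℓ m} ≤ Ideal.span {ℓ i, ℓ j} →
      Ideal.span {ℓ l, ℓ m} = Ideal.span {ℓ i, ℓ j} := by
    intro i j l m hij hlm hle
    have := hP i j hij
    have := hP l m hlm
    by_contra hcon
    -- Both primes have height two, so the inclusion cannot be strict.
    have h := Ideal.height_add_one_le_of_lt_of_isPrime (lt_of_le_of_ne hle hcon)
    rw [hheight i j hij, hheight l m hlm] at h
    exact absurd h (by decide)
  have hcomp : ∀ i j, i ≠ j → InCommonPencil ℓ i j →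
      ∃ q, IsNonreducedTopComponent (jacobianIdeal (∏ i, ℓ i)) q ∧
        q.radical = Ideal.span {ℓ i, ℓ j} := by
    rintro i j hij (h | ⟨l, hli, hlj, hl⟩)
    · exact absurd h hij
    have hi : ℓ i ∈ Ideal.span {ℓ i, ℓ j} := Ideal.subset_span (by simp)
    exact exists_isNonreducedTopComponent (span_pair_mem_minimalPrimes hlin hne' hP heq hij)
      (hheight i j hij)
      (jacobianIdeal_prod_le_sq hij hli.symm hlj.symm hi (Ideal.subset_span (by simp)) hl)
      hi (hlin i) (hne' i)
  refine isPencilPartition_inCommonPencil hP heq fun a i j l m hij hlm hr hr' ha ha' => ?_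
  obtain ⟨q, hq, hqr⟩ := hcomp i j hij hr
  obtain ⟨q', hq', hqr'⟩ := hcomp l m hlm hr'
  rw [← hqr, ← hqr', hplane a q q' hq hq' (hqr ▸ ha) (hqr' ▸ ha')]

theorem corollary3p4 {k : Type*} [Field k] [CharZero k] {d : ℕ}
    (ℓ : Fin d → MvPolynomial (Fin 4) k)
    (hlin : ∀ i, (ℓ i).IsHomogeneous 1) (hne : ∀ i, ℓ i ≠ 0)
    (hind : ∀ i j, i ≠ j → LinearIndependent k ![ℓ i, ℓ j])
    (hplane : ∀ i, ∀ q q' : Ideal (MvPolynomial (Fin 4) k),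
      IsNonreducedTopComponent (jacobianIdeal (∏ i, ℓ i)) q →
      IsNonreducedTopComponent (jacobianIdeal (∏ i, ℓ i)) q' →
      ℓ i ∈ q.radical → ℓ i ∈ q'.radical → q = q') :
    DefinesACMScheme (jacobianIdeal (∏ i, ℓ i)).radical ∧
      IsCohenMacaulayRing
        (MvPolynomial (Fin 4) k ⧸ (jacobianIdeal (∏ i, ℓ i)).radical) := by
  suffices saturation (jacobianIdeal (∏ i, ℓ i)).radical = (jacobianIdeal (∏ i, ℓ i)).radical ∧
      IsCohenMacaulayRing
        (MvPolynomial (Fin 4) k ⧸ (jacobianIdeal (∏ i, ℓ i)).radical) from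
    ⟨by rw [DefinesACMScheme, this.1]; exact this.2, this.2⟩
  -- For `d = 0`, `F = 1` has degree zero and Euler's formula says nothing; here `J = 0` and the
  -- quotient is the polynomial ring itself.
  rcases isEmpty_or_nonempty (Fin d) with hd | hd
  · rw [radical_jacobianIdeal_prod_of_isEmpty]
    refine ⟨saturation_eq_self (y := X 0) (Ideal.subset_span ⟨0, rfl⟩) fun n x hx => ?_,
      isCohenMacaulayRing_of_finiteFreeQuotient (k := k) (n := 4)
        (finiteFreeQuotient_of_bijective _ ⟨?_, Ideal.Quotient.mk_surjective⟩)⟩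
    · exact (mul_eq_zero.mp hx).resolve_right (pow_ne_zero n (X_ne_zero 0))
    · exact (RingHom.injective_iff_ker_eq_bot (Ideal.Quotient.mk ⊥)).mpr Ideal.mk_ker
  choose v hv using fun i => exists_linearForm_eq (hlin i)
  obtain rfl : (fun i => linearForm k (Fin 4) (v i)) = ℓ := funext hv
  have hindv : ∀ i j, i ≠ j → LinearIndependent k ![v i, v j] := by
    intro i j hij
    refine LinearIndependent.of_comp (linearForm k (Fin 4)) ?_
    convert! hind i j hij using 1
    ext l : 1
    fin_cases l <;> rfl
  have hnev : ∀ i, v i ≠ 0 := fun i hi => hne i (by simp [hi])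
  obtain ⟨y, z, hyz⟩ := exists_complementary_forms hindv
  have hprime := fun i j hij => isPrime_span_linearForm (hyz i j hij)
  rw [radical_jacobianIdeal_prod hlin hne hprime]
  refine ⟨saturation_eq_self (linearForm_mem_span_range_X y) fun n x hx => ?_, ?_⟩
  -- The form of `y` lies in none of the primes `(ℓ i, ℓ j)`, so it is a nonzerodivisor modulo their
  -- intersection, which is therefore already saturated.
  · rw [mem_pairwiseIdeal] at hx ⊢
    intro i hi j hj hij
    exact ((hprime i j hij).mem_or_mem (hx i hi j hj hij)).resolve_right fun h =>
      linearForm_notMem_span (hyz i j hij) ((hprime i j hij).mem_of_pow_mem n h)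
  · let : Algebra (MvPolynomial (Fin 2) k) (MvPolynomial (Fin 4) k) :=
      (planeInclusion y z).toRingHom.toAlgebra
    exact isCohenMacaulayRing_of_finiteFreeQuotient (k := k) (n := 2)
      ((isPencilPartition_of_unique_nonreduced hyz hnev hplane).finiteFreeQuotient_pairwiseIdeal
        (fun i j hij => finiteFreeQuotient_span_linearForm (fun _ => rfl) (hyz i j hij)) _)
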